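/- Let $m$ parties $A_1,\dots,A_m$ be given. For $l=1,\dots,L$ let $\mathcal E^l=\{\eta^l_i,\rho^l_i\}_{i=1}^{n_l}$ be an ensemble of $m$-party states: $\rho^l_1,\dots,\rho^l_{n_l}$ are density operators on $\mathcal H^l=\bigotimes_{k=1}^m\mathbb C^{d_{l,k}}$, where $A_k$ holds the factor $\mathbb C^{d_{l,k}}$, and $\eta^l_i>0$, $\sum_i\eta^l_i=1$. The sequence ensemble is $$\bigotimes_{l=1}^L\mathcal E^l=\{\eta_{\vec c},\rho_{\vec c}\}_{\vec c},\qquad \eta_{\vec c}=\prod_{l=1}^L\eta^l_{c_l},\quad \rho_{\vec c}=\bigotimes_{l=1}^L\rho^l_{c_l},\quad \vec c\in\prod_{l=1}^L\{1,\dots,n_l\},$$ regarded as an ensemble of $m$-party states in which $A_k$ holds $\bigotimes_{l=1}^L\mathbb C^{d_{l,k}}$. For an ensemble $\mathcal E=\{\eta_i,\rho_i\}_i$ of $m$-party states, let $$p_{\mathsf G}(\mathcal E)=\sup_{M}\sum_i\eta_i\operatorname{Tr}(\rho_iM_i),\qquad p_{\mathsf L}(\mathcal E)=\sup_{M\ \mathrm{LOCC}}\sum_i\eta_i\operatorname{Tr}(\rho_iM_i),$$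 where the first supremum is over all measurements $M=\{M_i\}_i$ ($M_i\ge 0$, $\sum_iM_i=\mathbb 1$), and the second over those that the $m$ parties can realize by local operations and classical communication (LOCC), that is, by a protocol of finitely many rounds in each of which one party performs a local quantum measurement with finitely many outcomes and broadcasts its outcome, the operations of all parties may depend on the outcomes broadcast so far, and the final guess is a function of these outcomes. Then $$\prod_{l=1}^{L}p_{\mathsf L}(\mathcal E^l)=p_{\mathsf L}\Big(\bigotimes_{l=1}^L\mathcal E^l\Big)=p_{\mathsf G}\Big(\bigotimes_{l=1}^L\mathcal E^l\Big)$$ if and only if $p_{\mathsf L}(\mathcal E^l)=p_{\mathsf G}(\mathcal E^l)$ for every $l=1,\dots,L$. -/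

import Mathlib

noncomputable section

namespace LOCCSeq

open Matrix
open scoped ComplexOrder

/-- The tensor product `⨂ₗ A l` of a finite family of (possibly rectangular) matrices, in the product
bases. -/
def piTensor {I : Type} [Fintype I] {a b : I → Type} (A : ∀ i, Matrix (a i) (b i) ℂ) :
    Matrix (∀ i, a i) (∀ i, b i) ℂ :=
  Matrix.of fun x y => ∏ i, A i (x i) (y i)

theorem piTensor_conjTranspose {I : Type} [Fintype I] {a b : I → Type}
    (A : ∀ i, Matrix (a i) (b i) ℂ) : (piTensor A)ᴴ = piTensor fun i => (A i)ᴴ := by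
  ext x y
  simp [piTensor, Matrix.conjTranspose_apply]

theorem piTensor_mul {I : Type} [Fintype I] [DecidableEq I] {a b c : I → Type}
    [∀ i, Fintype (b i)] (A : ∀ i, Matrix (a i) (b i) ℂ) (B : ∀ i, Matrix (b i) (c i) ℂ) :
    piTensor A * piTensor B = piTensor fun i => A i * B i := by
  ext x y
  simp [piTensor, Matrix.mul_apply, Finset.prod_univ_sum, Finset.prod_mul_distrib]

theorem piTensor_trace {I : Type} [Fintype I] [DecidableEq I] {a : I → Type}
    [∀ i, Fintype (a i)] (A : ∀ i, Matrix (a i) (a i) ℂ) :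
    (piTensor A).trace = ∏ i, (A i).trace := by
  simp [piTensor, Matrix.trace, Finset.prod_univ_sum]

theorem piTensor_posSemidef {I : Type} [Fintype I] [DecidableEq I] {a : I → Type}
    [∀ i, Fintype (a i)] (A : ∀ i, Matrix (a i) (a i) ℂ) (hA : ∀ i, (A i).PosSemidef) :
    (piTensor A).PosSemidef := by
  classical
  have h : ∀ i, ∃ B : Matrix (a i) (a i) ℂ, A i = Bᴴ * B := fun i => by
    open scoped MatrixOrder in
    exact CStarAlgebra.nonneg_iff_eq_star_mul_self.mp (hA i).nonneg
  choose B hB using h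
  have : piTensor A = (piTensor B)ᴴ * piTensor B := by
    rw [piTensor_conjTranspose, piTensor_mul]
    congr 1
    funext i
    exact hB i
  rw [this]
  exact Matrix.posSemidef_conjTranspose_mul_self _

/-- A quantum state ensemble `{η_i, ρ_i}` on the Hilbert space with orthonormal basis `H`: density
operators `ρ_i` prepared with nonzero probabilities `η_i`. -/
structure Ensemble (Ω H : Type) [Fintype Ω] [Fintype H] where
  prob : Ω → ℝ
  state : Ω → Matrix H H ℂ
  prob_pos : ∀ i, 0 < prob i
  prob_sum : ∑ i, prob i = 1
  state_posSemidef : ∀ i, (state i).PosSemidef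
  state_trace : ∀ i, (state i).trace = 1

/-- The average probability `∑ i, η_i Tr(ρ_i M_i)` of guessing correctly with the measurement `M`. -/
def Ensemble.success {Ω H : Type} [Fintype Ω] [Fintype H] (E : Ensemble Ω H)
    (M : Ω → Matrix H H ℂ) : ℝ :=
  ∑ i, E.prob i * ((E.state i * M i).trace).re

/-- A measurement: positive semidefinite operators that sum to the identity. -/
def IsMeasurement {Ω H : Type} [Fintype Ω] [Fintype H] [DecidableEq H]
    (M : Ω → Matrix H H ℂ) : Prop :=
  (∀ i, (M i).PosSemidef) ∧ ∑ i, M i = 1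

/-- `IsLOCC ι M`: the parties `k : P`, where party `k` holds a system with orthonormal basis `ι k`,
can realize the measurement `M` by local operations and classical communication.

* `guess c`: the parties stop and announce the outcome `c`.
* `round`: party `k` performs a local measurement with Kraus operators `B j k` (`j : Fin r`) and
  broadcasts the outcome `j`; given `j`, every other party `l` applies a local isometry `B j l`, for
  instance the identity or the adjunction of an ancilla.  Then the parties go on with an LOCC
  measurement `N j`, chosen according to `j`, of the resulting systems `ι' j`, whose dimensions may
  have changed.  The operators of the whole measurement are
  `∑ j, (⨂ₗ B j l)ᴴ * N j c * (⨂ₗ B j l)`.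

General local instruments and channels, local and shared randomness, and final classical processing
of the record are all covered: an outcome that is not revealed is one on which what follows does not
depend. -/
inductive IsLOCC {P : Type} [Fintype P] [DecidableEq P] {Ω : Type} [DecidableEq Ω] :
    (ι : P → Type) → [∀ k, Fintype (ι k)] → [∀ k, DecidableEq (ι k)] →
      (Ω → Matrix (∀ k, ι k) (∀ k, ι k) ℂ) → Prop
  | guess (ι : P → Type) [∀ k, Fintype (ι k)] [∀ k, DecidableEq (ι k)] (c : Ω) :
      IsLOCC ι fun c' => if c' = c then 1 else 0
  | round (ι : P → Type) [∀ k, Fintype (ι k)] [∀ k, DecidableEq (ι k)]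
      (k : P) (r : ℕ) (ι' : Fin r → P → Type)
      [∀ j l, Fintype (ι' j l)] [∀ j l, DecidableEq (ι' j l)]
      (B : ∀ (j : Fin r) (l : P), Matrix (ι' j l) (ι l) ℂ)
      (hk : ∑ j, (B j k)ᴴ * B j k = 1)
      (hl : ∀ j l, l ≠ k → (B j l)ᴴ * B j l = 1)
      (N : ∀ j : Fin r, Ω → Matrix (∀ l, ι' j l) (∀ l, ι' j l) ℂ)
      (hN : ∀ j, IsLOCC (ι' j) (N j)) :
      IsLOCC ι fun c => ∑ j, (piTensor (B j))ᴴ * N j c * piTensor (B j)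

/-- `p_G`: the optimal success probability over all measurements. -/
def pG {Ω H : Type} [Fintype Ω] [Fintype H] [DecidableEq H] (E : Ensemble Ω H) : ℝ :=
  sSup {p | ∃ M : Ω → Matrix H H ℂ, IsMeasurement M ∧ p = E.success M}

/-- `p_L`: the optimal success probability over all LOCC measurements among the parties `P`, where
party `k` holds the system with basis `ι k`. -/
def pL {P : Type} [Fintype P] [DecidableEq P] {ι : P → Type} [∀ k, Fintype (ι k)]
    [∀ k, DecidableEq (ι k)] {Ω : Type} [Fintype Ω] [DecidableEq Ω]
    (E : Ensemble Ω (∀ k, ι k)) : ℝ :=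
  sSup {p | ∃ M : Ω → Matrix (∀ k, ι k) (∀ k, ι k) ℂ, IsLOCC ι M ∧ p = E.success M}

/-- The sequence ensemble `⨂ₗ E l`, with probabilities `∏ₗ η^l_{c l}` and states `⨂ₗ ρ^l_{c l}`.
The `l`-th factor is shared among the parties `k : P`, and party `k` holds its part `ι l k` of every
factor: the local system of party `k` has the basis `∀ l, ι l k`. -/
def Ensemble.tensor {I P : Type} [Fintype I] [DecidableEq I] [Fintype P] [DecidableEq P]
    {ι : I → P → Type} [∀ l k, Fintype (ι l k)] {Ω : I → Type} [∀ l, Fintype (Ω l)]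
    (E : ∀ l, Ensemble (Ω l) (∀ k, ι l k)) :
    Ensemble (∀ l, Ω l) (∀ k, ∀ l, ι l k) where
  prob c := ∏ l, (E l).prob (c l)
  state c := (piTensor fun l => (E l).state (c l)).submatrix
    (fun x l k => x k l) (fun x l k => x k l)
  prob_pos c := Finset.prod_pos fun l _ => (E l).prob_pos (c l)
  prob_sum := by
    have h := Finset.prod_univ_sum (fun l => (Finset.univ : Finset (Ω l)))
      (fun l i => (E l).prob i)
    simp only [(E _).prob_sum, Finset.prod_const_one, Fintype.piFinset_univ] at h
    exact h.symm
  state_posSemidef c :=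
    (piTensor_posSemidef _ fun l => (E l).state_posSemidef (c l)).submatrix _
  state_trace c := by
    have h : (piTensor fun l => (E l).state (c l)).trace = 1 := by
      rw [piTensor_trace]
      exact Finset.prod_eq_one fun l _ => (E l).state_trace (c l)
    rw [← h]
    exact Equiv.sum_comp (Equiv.piComm fun k l => ι l k)
      (fun z => piTensor (fun l => (E l).state (c l)) z z)

end LOCCSeq

end

/-!
Guessing with the rewards `W i = η_i ρ_i` is a semidefinite program whose dual minimizes `Tr K`
subject to `W i ≤ K` for all `i`.  At an optimal measurement `M` the Hermitian part of
`∑ i, W i * M i` is dual feasible, so there is no duality gap.  Tensor products of optimal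
measurements and of optimal dual points certify each other, since tensor products are monotone on
positive semidefinite operators; hence `pG` is multiplicative.  Carrying out LOCC protocols one
after the other on the factors shows that `pL` is supermultiplicative, so that
`∏ pL (E l) ≤ pL (⨂ E l) ≤ pG (⨂ E l) = ∏ pG (E l)`.
The outer terms are products of positive numbers with `pL (E l) ≤ pG (E l)`, and so agree only if
all factors do.
-/

namespace LOCCSeq

open Matrix
open scoped ComplexOrder Kronecker MatrixOrder

section MatrixFacts

variable {H : Type*} [Fintype H]

theorem trace_submatrix_equiv {R m n : Type*} [AddCommMonoid R] [Fintype m] [Fintype n]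
    (A : Matrix n n R) (e : m ≃ n) : (A.submatrix e e).trace = A.trace :=
  Equiv.sum_comp e fun i => A i i

theorem trace_mul_nonneg {𝕜 : Type*} [RCLike 𝕜] {A B : Matrix H H 𝕜} (hA : A.PosSemidef)
    (hB : B.PosSemidef) : 0 ≤ (A * B).trace := by
  classical
  obtain ⟨C, rfl⟩ := CStarAlgebra.nonneg_iff_eq_star_mul_self.mp hB.nonneg
  rw [← Matrix.mul_assoc, trace_mul_comm, ← Matrix.mul_assoc]
  exact (hA.mul_mul_conjTranspose_same C).trace_nonneg

theorem ofReal_re_trace_mul {A B : Matrix H H ℂ} (hA : A.IsHermitian) (hB : B.IsHermitian) :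
    ((A * B).trace.re : ℂ) = (A * B).trace := by
  rw [← Complex.conj_eq_iff_re, starRingEnd_apply, ← trace_conjTranspose, conjTranspose_mul,
    hA.eq, hB.eq, trace_mul_comm]

theorem re_trace_realPart_mul (A : Matrix H H ℂ) {B : Matrix H H ℂ} (hB : B.IsHermitian) :
    ((realPart A : Matrix H H ℂ) * B).trace.re = (A * B).trace.re := by
  have hstar : (star A * B).trace.re = (A * B).trace.re := by
    rw [← Complex.conj_re, starRingEnd_apply, ← trace_conjTranspose, conjTranspose_mul,
      star_eq_conjTranspose, conjTranspose_conjTranspose, hB.eq, trace_mul_comm]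
  rw [realPart_apply_coe, Matrix.smul_mul, trace_smul, Complex.smul_re, Matrix.add_mul, trace_add,
    Complex.add_re, hstar, smul_eq_mul]
  ring

theorem posSemidef_of_forall_isStarProjection {A : Matrix H H ℂ} (hA : A.IsHermitian)
    (h : ∀ P : Matrix H H ℂ, IsStarProjection P → 0 ≤ (A * P).trace.re) : A.PosSemidef := by
  classical
  rw [hA.posSemidef_iff_eigenvalues_nonneg]
  intro i
  set v : H → ℂ := (hA.eigenvectorBasis i).ofLp
  have hv : star v ⬝ᵥ v = 1 := by
    have := inner_self_eq_norm_sq_to_K (𝕜 := ℂ) (hA.eigenvectorBasis i)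
    rw [hA.eigenvectorBasis.orthonormal.1 i, EuclideanSpace.inner_eq_star_dotProduct] at this
    simpa [dotProduct_comm] using this
  have hP : IsStarProjection (vecMulVec v (star v)) :=
    ⟨by rw [IsIdempotentElem, vecMulVec_mul_vecMulVec, hv, one_smul],
      by simp [IsSelfAdjoint, star_eq_conjTranspose, conjTranspose_vecMulVec]⟩
  have htrace := h _ hP
  rwa [mul_vecMulVec, trace_vecMulVec, dotProduct_comm, ← RCLike.re_eq_complex_re,
    ← hA.eigenvalues_eq] at htrace

theorem re_trace_mul_one_sub_smul_conj [DecidableEq H] {W M P : Matrix H H ℂ}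
    (hW : W.IsHermitian) (hM : M.IsHermitian) (hP : P.IsHermitian) (ε : ℝ) :
    (W * ((1 - ε • P) * M * (1 - ε • P))).trace.re =
      (W * M).trace.re - 2 * ε * (W * M * P).trace.re + ε ^ 2 * (W * (P * M * P)).trace.re := by
  have hexpand : W * ((1 - ε • P) * M * (1 - ε • P)) =
      W * M - ε • (W * (P * M)) - ε • (W * M * P) + ε ^ 2 • (W * (P * M * P)) := by
    simp only [Matrix.sub_mul, Matrix.mul_sub, Matrix.one_mul, Matrix.mul_one, Matrix.smul_mul,
      Matrix.mul_smul, Matrix.mul_assoc]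
    module
  have hsymm : (W * (P * M)).trace.re = (W * M * P).trace.re := by
    rw [← Complex.conj_re, starRingEnd_apply, ← trace_conjTranspose, conjTranspose_mul,
      conjTranspose_mul, hW.eq, hM.eq, hP.eq, trace_mul_comm, Matrix.mul_assoc]
  simp only [hexpand, trace_add, trace_sub, trace_smul, Complex.add_re, Complex.sub_re,
    Complex.smul_re, smul_eq_mul, hsymm]
  ring

end MatrixFacts

theorem nonneg_of_forall_mul_le {a C : ℝ} (h : ∀ ε ∈ Set.Ioc (0 : ℝ) 1, ε * C ≤ a) : 0 ≤ a := by
  have hlim : Filter.Tendsto (fun ε : ℝ => ε * C) (nhdsWithin 0 (Set.Ioi 0)) (nhds 0) := by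
    have hcont : Continuous fun ε : ℝ => ε * C := by fun_prop
    simpa using (hcont.tendsto 0).mono_left nhdsWithin_le_nhds
  exact le_of_tendsto hlim (Filter.eventually_of_mem (Ioc_mem_nhdsGT one_pos) h)

section Duality

variable {Ω H : Type} [Fintype Ω] [Fintype H]

/-- The payoff of the measurement `M` when the operator `W i` is the reward for the outcome `i`.
For `W i = η_i ρ_i` it is the probability of guessing the state. -/
def payoff (W M : Ω → Matrix H H ℂ) : ℝ :=
  ∑ i, (W i * M i).trace.re

theorem ofReal_payoff {W M : Ω → Matrix H H ℂ} (hW : ∀ i, (W i).IsHermitian)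
    (hM : ∀ i, (M i).IsHermitian) : (payoff W M : ℂ) = (∑ i, W i * M i).trace := by
  simp only [payoff, Complex.ofReal_sum, ofReal_re_trace_mul (hW _) (hM _), trace_sum]

variable [DecidableEq H]

theorem payoff_le_trace_re {W M : Ω → Matrix H H ℂ} {K : Matrix H H ℂ} (hK : ∀ i, W i ≤ K)
    (hM : IsMeasurement M) : payoff W M ≤ K.trace.re := by
  have hK_trace : K.trace.re = ∑ i, (K * M i).trace.re := by
    rw [← Complex.re_sum, ← trace_sum, ← Matrix.mul_sum, hM.2, Matrix.mul_one]
  rw [payoff, hK_trace]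
  refine Finset.sum_le_sum fun i _ => ?_
  have hgap := (Complex.le_def.mp (trace_mul_nonneg (hK i) (hM.1 i))).1
  simpa only [Matrix.sub_mul, trace_sub, Complex.sub_re, Complex.zero_re, sub_nonneg] using hgap

theorem isMeasurement_iff {M : Ω → Matrix H H ℂ} :
    IsMeasurement M ↔ (∀ i, 0 ≤ M i) ∧ ∑ i, M i = 1 := by
  simp only [IsMeasurement, nonneg_iff_posSemidef]

theorem IsMeasurement.le_one {M : Ω → Matrix H H ℂ} (hM : IsMeasurement M) (i : Ω) : M i ≤ 1 := by
  rw [isMeasurement_iff] at hM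
  exact hM.2 ▸ Finset.single_le_sum (fun j _ => hM.1 j) (Finset.mem_univ i)

theorem isMeasurement_guess [DecidableEq Ω] (c : Ω) :
    IsMeasurement fun c' => if c' = c then (1 : Matrix H H ℂ) else 0 := by
  refine ⟨fun i => ?_, by simp⟩
  beta_reduce
  split_ifs
  exacts [PosSemidef.one, PosSemidef.zero]

open scoped Matrix.Norms.L2Operator in
theorem isCompact_setOf_isMeasurement : IsCompact {M : Ω → Matrix H H ℂ | IsMeasurement M} := by
  have hball : IsCompact (Metric.closedBall (0 : Ω → Matrix H H ℂ) 1) :=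
    have := FiniteDimensional.proper ℂ (Ω → Matrix H H ℂ)
    isCompact_closedBall _ _
  refine hball.of_isClosed_subset ?_ fun M hM => ?_
  · simp only [isMeasurement_iff, Set.ofPred_and, Set.ofPred_forall]
    refine IsClosed.inter (isClosed_iInter fun i => ?_) ?_
    · exact isClosed_le continuous_const (continuous_apply i)
    · exact isClosed_eq (by fun_prop) continuous_const
  · rw [mem_closedBall_zero_iff, pi_norm_le_iff_of_nonneg zero_le_one]
    exact fun i => (CStarAlgebra.norm_le_one_iff_of_nonneg (M i) (hM.1 i).nonneg).mpr (hM.le_one i)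

theorem exists_isMaxOn_payoff [Nonempty Ω] (W : Ω → Matrix H H ℂ) :
    ∃ M, IsMeasurement M ∧ IsMaxOn (payoff W) {M | IsMeasurement M} M := by
  classical
  exact isCompact_setOf_isMeasurement.exists_isMaxOn
    ⟨_, isMeasurement_guess (Classical.arbitrary Ω)⟩ (by unfold payoff; fun_prop)

section Nudge

variable [DecidableEq Ω]

/-- The measurement that first tests weakly for the projection `P`, announces `j` if the test
succeeds, and otherwise goes on with `M`.  Failure has the Kraus operator `1 - ε P`, so success has
the operator `1 - (1 - ε P)² = ε (2 - ε) P`.  Its payoff is differentiated at `ε = 0`. -/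
noncomputable def nudge (M : Ω → Matrix H H ℂ) (P : Matrix H H ℂ) (j : Ω) (ε : ℝ) :
    Ω → Matrix H H ℂ :=
  fun i => (1 - ε • P) * M i * (1 - ε • P) + if i = j then (ε * (2 - ε)) • P else 0

theorem IsMeasurement.nudge {M : Ω → Matrix H H ℂ} (hM : IsMeasurement M) {P : Matrix H H ℂ}
    (hP : IsStarProjection P) (j : Ω) {ε : ℝ} (h0 : 0 ≤ ε) (h2 : ε ≤ 2) :
    IsMeasurement (nudge M P j ε) := by
  rw [isMeasurement_iff] at hM ⊢
  have hfail : IsSelfAdjoint (1 - ε • P) :=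
    (IsSelfAdjoint.one _).sub ((IsSelfAdjoint.all ε).smul hP.isSelfAdjoint)
  refine ⟨fun i => add_nonneg (IsSelfAdjoint.conjugate_nonneg (hM.1 i) hfail) ?_, ?_⟩
  · split_ifs
    exacts [smul_nonneg (mul_nonneg h0 (sub_nonneg.mpr h2)) hP.nonneg, le_rfl]
  · simp only [LOCCSeq.nudge]
    rw [Finset.sum_add_distrib, ← Finset.sum_mul, ← Finset.mul_sum, hM.2]
    simp only [Finset.sum_ite_eq', Finset.mem_univ, if_true, Matrix.mul_one, Matrix.sub_mul,
      Matrix.mul_sub, Matrix.one_mul, Matrix.smul_mul, Matrix.mul_smul, hP.isIdempotentElem.eq]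
    module

theorem payoff_nudge {W M : Ω → Matrix H H ℂ} (hW : ∀ i, (W i).IsHermitian)
    (hM : ∀ i, (M i).IsHermitian) {P : Matrix H H ℂ} (hP : P.IsHermitian) (j : Ω) (ε : ℝ) :
    payoff W (nudge M P j ε) = payoff W M
      - 2 * ε * (((∑ i, W i * M i) * P).trace.re - (W j * P).trace.re)
      + ε ^ 2 * (payoff W (fun i => P * M i * P) - (W j * P).trace.re) := by
  have hj : ∑ i, (W i * if i = j then (ε * (2 - ε)) • P else 0).trace.re =
      ε * (2 - ε) * (W j * P).trace.re := by
    simp [mul_ite, apply_ite Matrix.trace, apply_ite Complex.re]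
  simp only [payoff, nudge, Matrix.mul_add, trace_add, Complex.add_re, Finset.sum_add_distrib, hj,
    re_trace_mul_one_sub_smul_conj (hW _) (hM _) hP, Finset.sum_sub_distrib, ← Finset.mul_sum,
    Finset.sum_mul, trace_sum, Complex.re_sum]
  ring

end Nudge

/-- An optimality certificate for the problem of maximizing `payoff W` over measurements: a
measurement `M` and a feasible point `K` of the dual semidefinite program with the same value. -/
structure IsOptimalPair (W M : Ω → Matrix H H ℂ) (K : Matrix H H ℂ) : Prop where
  isMeasurement : IsMeasurement M
  le_dual : ∀ i, W i ≤ K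
  trace_eq : K.trace = payoff W M

theorem IsOptimalPair.payoff_le {W M : Ω → Matrix H H ℂ} {K : Matrix H H ℂ}
    (h : IsOptimalPair W M K) {N : Ω → Matrix H H ℂ} (hN : IsMeasurement N) :
    payoff W N ≤ payoff W M := by
  simpa only [h.trace_eq, Complex.ofReal_re] using payoff_le_trace_re h.le_dual hN

theorem le_realPart_of_isMaxOn {W M : Ω → Matrix H H ℂ} (hW : ∀ i, (W i).IsHermitian)
    (hM : IsMeasurement M) (hmax : IsMaxOn (payoff W) {M | IsMeasurement M} M) (j : Ω) :
    W j ≤ realPart (∑ i, W i * M i) := by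
  classical
  refine posSemidef_of_forall_isStarProjection (.sub (realPart _).2 (hW j)) fun P hP => ?_
  have hP' : P.IsHermitian := hP.isSelfAdjoint
  rw [Matrix.sub_mul, trace_sub, Complex.sub_re, re_trace_realPart_mul _ hP']
  set a := ((∑ i, W i * M i) * P).trace.re - (W j * P).trace.re with ha
  set C := payoff W (fun i => P * M i * P) - (W j * P).trace.re with hC
  suffices 0 ≤ 2 * a by linarith
  refine nonneg_of_forall_mul_le (C := C) fun ε hε => ?_
  have hle : payoff W (nudge M P j ε) ≤ payoff W M :=
    hmax (hM.nudge hP j hε.1.le (hε.2.trans one_le_two))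
  rw [payoff_nudge hW (fun i => (hM.1 i).isHermitian) hP', ← ha, ← hC] at hle
  exact le_of_mul_le_mul_left (by linarith : ε * (ε * C) ≤ ε * (2 * a)) hε.1

theorem exists_isOptimalPair [Nonempty Ω] {W : Ω → Matrix H H ℂ}
    (hW : ∀ i, (W i).IsHermitian) : ∃ M K, IsOptimalPair W M K := by
  obtain ⟨M, hM, hmax⟩ := exists_isMaxOn_payoff W
  refine ⟨M, realPart (∑ i, W i * M i), hM, le_realPart_of_isMaxOn hW hM hmax, ?_⟩
  have hreal := ofReal_re_trace_mul (realPart (∑ i, W i * M i)).2 isHermitian_one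
  rw [re_trace_realPart_mul _ isHermitian_one, Matrix.mul_one, Matrix.mul_one] at hreal
  rw [← hreal, ← ofReal_payoff hW fun i => (hM.1 i).isHermitian, Complex.ofReal_re]

end Duality

section PiTensor

variable {I : Type} [Fintype I]

theorem piTensor_one {a : I → Type} [∀ i, DecidableEq (a i)] :
    piTensor (fun i => (1 : Matrix (a i) (a i) ℂ)) = 1 := by
  ext x y
  simp only [piTensor, of_apply, one_apply, Fintype.prod_ite_zero, Finset.prod_const_one,
    funext_iff]

theorem piTensor_sum [DecidableEq I] {a b β : I → Type} [∀ i, Fintype (β i)]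
    (A : ∀ i, β i → Matrix (a i) (b i) ℂ) :
    piTensor (fun i => ∑ j, A i j) = ∑ c : ∀ i, β i, piTensor fun i => A i (c i) := by
  ext x y
  simp [piTensor, Matrix.sum_apply, Finset.prod_univ_sum]

theorem sum_piTensor_eq_one {J : Type*} [Fintype J] {a : I → Type} [∀ i, DecidableEq (a i)]
    (k : I) (A : ∀ (_ : J) (i : I), Matrix (a i) (a i) ℂ) (hk : ∑ j, A j k = 1)
    (hne : ∀ j i, i ≠ k → A j i = 1) : ∑ j, piTensor (A j) = 1 := by
  classical
  rw [← piTensor_one]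
  ext x y
  simp only [Matrix.sum_apply, piTensor, of_apply, ← Finset.mul_prod_erase _ _ (Finset.mem_univ k)]
  rw [← hk, Matrix.sum_apply, Finset.sum_mul]
  refine Finset.sum_congr rfl fun j _ => ?_
  congr 1
  exact Finset.prod_congr rfl fun i hi => by rw [hne j i (Finset.ne_of_mem_erase hi)]

theorem piTensor_mono {a : I → Type} [∀ i, Finite (a i)] {A B : ∀ i, Matrix (a i) (a i) ℂ}
    (hA : ∀ i, 0 ≤ A i) (hAB : ∀ i, A i ≤ B i) : piTensor A ≤ piTensor B := by
  classical
  have (i : I) := Fintype.ofFinite (a i)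
  let part (i : I) (b : Bool) : Matrix (a i) (a i) ℂ := if b then A i else B i - A i
  have hpart (c : I → Bool) : 0 ≤ piTensor fun i => part i (c i) := by
    refine (piTensor_posSemidef _ fun i => ?_).nonneg
    unfold part
    split_ifs
    exacts [(hA i).posSemidef, (sub_nonneg.mpr (hAB i)).posSemidef]
  calc piTensor A = piTensor fun i => part i true := rfl
    _ ≤ ∑ c : I → Bool, piTensor fun i => part i (c i) :=
      Finset.single_le_sum (f := fun c : I → Bool => piTensor fun i => part i (c i))
        (fun c _ => hpart c) (Finset.mem_univ fun _ => true)
    _ = piTensor fun i => ∑ b, part i b := (piTensor_sum part).symm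
    _ = piTensor B := by simp [part]

end PiTensor

section PartyTensor

variable {I P : Type} [Fintype I] {ι : I → P → Type}

/-- The tensor product of operators `A l` on multipartite systems, as an operator on the
multipartite system in which party `k` holds its part `ι l k` of every factor `l`. -/
def partyTensor (A : ∀ l, Matrix (∀ k, ι l k) (∀ k, ι l k) ℂ) :
    Matrix (∀ k l, ι l k) (∀ k l, ι l k) ℂ :=
  (piTensor A).submatrix (Equiv.piComm fun k l => ι l k) (Equiv.piComm fun k l => ι l k)

theorem isHermitian_partyTensor {A : ∀ l, Matrix (∀ k, ι l k) (∀ k, ι l k) ℂ}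
    (hA : ∀ l, (A l).IsHermitian) : (partyTensor A).IsHermitian := by
  refine IsHermitian.submatrix ?_ _
  simp only [IsHermitian, piTensor_conjTranspose, (hA _).eq]

theorem partyTensor_mono [Finite P] [∀ l k, Finite (ι l k)]
    {A B : ∀ l, Matrix (∀ k, ι l k) (∀ k, ι l k) ℂ} (hA : ∀ l, 0 ≤ A l) (hAB : ∀ l, A l ≤ B l) :
    partyTensor A ≤ partyTensor B :=
  PosSemidef.submatrix (piTensor_mono hA hAB) _

theorem partyTensor_one [Fintype P] [∀ l k, DecidableEq (ι l k)] :
    partyTensor (fun l => (1 : Matrix (∀ k, ι l k) (∀ k, ι l k) ℂ)) = 1 := by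
  rw [partyTensor, piTensor_one, submatrix_one_equiv]

variable [DecidableEq I]

theorem partyTensor_sum {β : I → Type} [∀ l, Fintype (β l)]
    (A : ∀ l, β l → Matrix (∀ k, ι l k) (∀ k, ι l k) ℂ) :
    partyTensor (fun l => ∑ i, A l i) = ∑ c : ∀ l, β l, partyTensor fun l => A l (c l) := by
  rw [partyTensor, piTensor_sum]
  ext x y
  simp only [Matrix.sum_apply, submatrix_apply, partyTensor]

variable [Fintype P] [DecidableEq P] [∀ l k, Fintype (ι l k)]

theorem partyTensor_mul (A B : ∀ l, Matrix (∀ k, ι l k) (∀ k, ι l k) ℂ) :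
    partyTensor A * partyTensor B = partyTensor fun l => A l * B l := by
  rw [partyTensor, partyTensor, submatrix_mul_equiv, piTensor_mul, partyTensor]

theorem trace_partyTensor (A : ∀ l, Matrix (∀ k, ι l k) (∀ k, ι l k) ℂ) :
    (partyTensor A).trace = ∏ l, (A l).trace := by
  rw [partyTensor, trace_submatrix_equiv, piTensor_trace]

variable {Ω : I → Type} [∀ l, Fintype (Ω l)]
  {W M : ∀ l, Ω l → Matrix (∀ k, ι l k) (∀ k, ι l k) ℂ}

theorem payoff_partyTensor (hW : ∀ l i, (W l i).IsHermitian) (hM : ∀ l i, (M l i).IsHermitian) :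
    payoff (fun c : ∀ l, Ω l => partyTensor fun l => W l (c l))
        (fun c : ∀ l, Ω l => partyTensor fun l => M l (c l)) =
      ∏ l, payoff (W l) (M l) := by
  apply Complex.ofReal_injective
  rw [ofReal_payoff (fun c : ∀ l, Ω l => isHermitian_partyTensor fun l => hW l (c l))
    fun c : ∀ l, Ω l => isHermitian_partyTensor fun l => hM l (c l)]
  simp only [partyTensor_mul, Complex.ofReal_prod, ofReal_payoff (hW _) (hM _)]
  rw [← trace_partyTensor, partyTensor_sum]

variable [∀ l k, DecidableEq (ι l k)]

theorem IsMeasurement.partyTensor (hM : ∀ l, IsMeasurement (M l)) :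
    IsMeasurement fun c : ∀ l, Ω l => partyTensor fun l => M l (c l) := by
  refine ⟨fun c => (piTensor_posSemidef _ fun l => (hM l).1 (c l)).submatrix _, ?_⟩
  rw [← partyTensor_sum]
  simp only [(hM _).2, partyTensor_one]

theorem IsOptimalPair.partyTensor {K : ∀ l, Matrix (∀ k, ι l k) (∀ k, ι l k) ℂ}
    (hW : ∀ l i, 0 ≤ W l i) (h : ∀ l, IsOptimalPair (W l) (M l) (K l)) :
    IsOptimalPair (fun c : ∀ l, Ω l => partyTensor fun l => W l (c l))
      (fun c : ∀ l, Ω l => partyTensor fun l => M l (c l)) (partyTensor K) where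
  isMeasurement := IsMeasurement.partyTensor fun l => (h l).isMeasurement
  le_dual c := partyTensor_mono (fun l => hW l (c l)) fun l => (h l).le_dual (c l)
  trace_eq := by
    rw [trace_partyTensor, payoff_partyTensor (fun l i => (hW l i).posSemidef.isHermitian)
      fun l i => ((h l).isMeasurement.1 i).isHermitian, Complex.ofReal_prod]
    exact Finset.prod_congr rfl fun l _ => (h l).trace_eq

end PartyTensor

namespace Ensemble

variable {Ω H : Type} [Fintype Ω] [Fintype H] (E : Ensemble Ω H)

/-- The unnormalized state `η_i ρ_i`. -/
noncomputable def weightedState (i : Ω) : Matrix H H ℂ :=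
  E.prob i • E.state i

theorem weightedState_nonneg (i : Ω) : 0 ≤ E.weightedState i :=
  smul_nonneg (E.prob_pos i).le (E.state_posSemidef i).nonneg

theorem weightedState_isHermitian (i : Ω) : (E.weightedState i).IsHermitian :=
  (E.weightedState_nonneg i).posSemidef.isHermitian

theorem success_eq_payoff (M : Ω → Matrix H H ℂ) : E.success M = payoff E.weightedState M := by
  simp only [success, payoff, weightedState, Matrix.smul_mul, trace_smul, Complex.smul_re,
    smul_eq_mul]

include E in
theorem nonempty : Nonempty Ω := by
  by_contra hΩ
  rw [not_nonempty_iff] at hΩ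
  simpa using E.prob_sum

variable [DecidableEq H]

variable {E} in
theorem pG_eq_payoff_of_isOptimalPair {M : Ω → Matrix H H ℂ} {K : Matrix H H ℂ}
    (h : IsOptimalPair E.weightedState M K) : pG E = payoff E.weightedState M := by
  refine IsGreatest.csSup_eq ⟨⟨M, h.isMeasurement, (E.success_eq_payoff M).symm⟩, ?_⟩
  rintro _ ⟨N, hN, rfl⟩
  exact (E.success_eq_payoff N).trans_le (h.payoff_le hN)

theorem exists_isOptimalPair : ∃ M K, IsOptimalPair E.weightedState M K :=
  have := E.nonempty
  LOCCSeq.exists_isOptimalPair E.weightedState_isHermitian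

theorem success_le_pG {M : Ω → Matrix H H ℂ} (hM : IsMeasurement M) : E.success M ≤ pG E := by
  obtain ⟨_, _, h⟩ := E.exists_isOptimalPair
  rw [pG_eq_payoff_of_isOptimalPair h, success_eq_payoff]
  exact h.payoff_le hM

end Ensemble

section Sequence

variable {I P : Type} [Fintype I] [DecidableEq I] [Fintype P] [DecidableEq P]
  {ι : I → P → Type} [∀ l k, Fintype (ι l k)] {Ω : I → Type} [∀ l, Fintype (Ω l)]
  (E : ∀ l, Ensemble (Ω l) (∀ k, ι l k))

theorem Ensemble.weightedState_tensor :
    (Ensemble.tensor E).weightedState =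
      fun c => partyTensor fun l => (E l).weightedState (c l) := by
  funext c
  ext x y
  simp only [weightedState, Ensemble.tensor, partyTensor, piTensor, Matrix.smul_apply,
    submatrix_apply, of_apply, Finset.prod_smul]
  rfl

theorem Ensemble.success_tensor {M : ∀ l, Ω l → Matrix (∀ k, ι l k) (∀ k, ι l k) ℂ}
    (hM : ∀ l i, (M l i).IsHermitian) :
    (Ensemble.tensor E).success (fun c => partyTensor fun l => M l (c l)) =
      ∏ l, (E l).success (M l) := by
  simp only [success_eq_payoff, weightedState_tensor]
  exact payoff_partyTensor (fun l => (E l).weightedState_isHermitian) hM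

theorem Ensemble.pG_tensor [∀ l k, DecidableEq (ι l k)] :
    pG (Ensemble.tensor E) = ∏ l, pG (E l) := by
  choose M K h using fun l => (E l).exists_isOptimalPair
  have htensor := IsOptimalPair.partyTensor (fun l => (E l).weightedState_nonneg) h
  rw [← weightedState_tensor] at htensor
  rw [pG_eq_payoff_of_isOptimalPair htensor, ← success_eq_payoff,
    success_tensor E fun l i => ((h l).isMeasurement.1 i).isHermitian]
  exact Finset.prod_congr rfl fun l _ =>
    ((E l).success_eq_payoff _).trans (pG_eq_payoff_of_isOptimalPair (h l)).symm

end Sequence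

section LOCC

variable {P : Type} [Fintype P] [DecidableEq P]

theorem IsLOCC.isMeasurement {Ω : Type} [Fintype Ω] [DecidableEq Ω] {ι : P → Type}
    [∀ k, Fintype (ι k)] [∀ k, DecidableEq (ι k)] {M : Ω → Matrix (∀ k, ι k) (∀ k, ι k) ℂ}
    (h : IsLOCC ι M) : IsMeasurement M := by
  induction h with
  | guess ι c => exact isMeasurement_guess c
  | round ι k r ι' B hk hne N _ ih =>
    refine ⟨fun c => posSemidef_sum _ fun j _ => ((ih j).1 c).conjTranspose_mul_mul_same _, ?_⟩
    calc ∑ c, ∑ j, (piTensor (B j))ᴴ * N j c * piTensor (B j)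
        = ∑ j, piTensor fun l => (B j l)ᴴ * B j l := by
          rw [Finset.sum_comm]
          refine Finset.sum_congr rfl fun j _ => ?_
          rw [← Matrix.sum_mul, ← Matrix.mul_sum, (ih j).2, Matrix.mul_one,
            piTensor_conjTranspose, piTensor_mul]
      _ = 1 := sum_piTensor_eq_one k _ hk hne

section Ensemble

variable {Ω : Type} [Fintype Ω] [DecidableEq Ω] {ι : P → Type} [∀ k, Fintype (ι k)]
  [∀ k, DecidableEq (ι k)] (E : Ensemble Ω (∀ k, ι k))

theorem Ensemble.nonempty_setOf_success_isLOCC :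
    {p | ∃ M : Ω → Matrix (∀ k, ι k) (∀ k, ι k) ℂ, IsLOCC ι M ∧ p = E.success M}.Nonempty :=
  E.nonempty.elim fun c => ⟨_, _, IsLOCC.guess ι c, rfl⟩

theorem Ensemble.bddAbove_setOf_success_isLOCC :
    BddAbove {p | ∃ M : Ω → Matrix (∀ k, ι k) (∀ k, ι k) ℂ, IsLOCC ι M ∧ p = E.success M} := by
  refine ⟨pG E, ?_⟩
  rintro _ ⟨M, hM, rfl⟩
  exact E.success_le_pG hM.isMeasurement

theorem Ensemble.success_le_pL {M : Ω → Matrix (∀ k, ι k) (∀ k, ι k) ℂ} (hM : IsLOCC ι M) :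
    E.success M ≤ pL E :=
  le_csSup E.bddAbove_setOf_success_isLOCC ⟨M, hM, rfl⟩

theorem Ensemble.pL_le_pG : pL E ≤ pG E := by
  refine csSup_le E.nonempty_setOf_success_isLOCC ?_
  rintro _ ⟨M, hM, rfl⟩
  exact E.success_le_pG hM.isMeasurement

theorem Ensemble.pL_pos : 0 < pL E := by
  obtain ⟨c⟩ := E.nonempty
  calc 0 < E.prob c := E.prob_pos c
    _ = E.success fun c' => if c' = c then 1 else 0 := by
      simp [success, mul_ite, apply_ite Matrix.trace, apply_ite Complex.re, E.state_trace]
    _ ≤ pL E := E.success_le_pL (.guess ι c)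

end Ensemble

theorem IsLOCC.relabel {Ω Ω' : Type} [DecidableEq Ω] [DecidableEq Ω'] (f : Ω' ≃ Ω)
    {ι : P → Type} [∀ k, Fintype (ι k)] [∀ k, DecidableEq (ι k)]
    {M : Ω → Matrix (∀ k, ι k) (∀ k, ι k) ℂ} (h : IsLOCC ι M)
    {κ : P → Type} [∀ k, Fintype (κ k)] [∀ k, DecidableEq (κ k)] (e : ∀ k, κ k ≃ ι k) :
    IsLOCC κ fun c => (M (f c)).submatrix (Equiv.piCongrRight e) (Equiv.piCongrRight e) := by
  induction h generalizing κ with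
  | guess ι c =>
    convert IsLOCC.guess κ (f.symm c) using 2 with c'
    simp only [Equiv.eq_symm_apply]
    split_ifs
    exacts [submatrix_one_equiv (Equiv.piCongrRight e), rfl]
  | round ι k r ι' B hk hne N _ ih =>
    have hgram (j : Fin r) (l : P) : ((B j l).submatrix id (e l))ᴴ * (B j l).submatrix id (e l) =
        ((B j l)ᴴ * B j l).submatrix (e l) (e l) := rfl
    convert IsLOCC.round κ k r ι' (fun j l => (B j l).submatrix id (e l)) ?_ ?_
      (fun j c => N j (f c)) (fun j => ih j fun _ => Equiv.refl _) using 2 with c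
    · ext x y
      simp only [submatrix_apply, Matrix.sum_apply]
      rfl
    · simp only [hgram]
      rw [← submatrix_one_equiv (e k), ← hk]
      ext x y
      simp only [Matrix.sum_apply, submatrix_apply]
    · intro j l hl
      rw [hgram, hne j l hl, submatrix_one_equiv]

/-- The tensor product of operators on two multipartite systems, as an operator between the
multipartite systems in which every party holds its parts of both factors. -/
def partyKronecker {ι κ ι' κ' : P → Type} (A : Matrix (∀ k, ι k) (∀ k, ι' k) ℂ)
    (B : Matrix (∀ k, κ k) (∀ k, κ' k) ℂ) : Matrix (∀ k, ι k × κ k) (∀ k, ι' k × κ' k) ℂ :=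
  (A ⊗ₖ B).submatrix (Equiv.arrowProdEquivProdArrow P ι κ) (Equiv.arrowProdEquivProdArrow P ι' κ')

section PartyKronecker

variable {ι κ ι' κ' ι'' κ'' : P → Type}

omit [Fintype P] [DecidableEq P] in
theorem conjTranspose_partyKronecker (A : Matrix (∀ k, ι k) (∀ k, ι' k) ℂ)
    (B : Matrix (∀ k, κ k) (∀ k, κ' k) ℂ) : (partyKronecker A B)ᴴ = partyKronecker Aᴴ Bᴴ := by
  rw [partyKronecker, conjTranspose_submatrix, conjTranspose_kronecker, partyKronecker]

theorem partyKronecker_mul [∀ k, Fintype (ι' k)] [∀ k, Fintype (κ' k)]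
    (A : Matrix (∀ k, ι k) (∀ k, ι' k) ℂ) (B : Matrix (∀ k, κ k) (∀ k, κ' k) ℂ)
    (A' : Matrix (∀ k, ι' k) (∀ k, ι'' k) ℂ) (B' : Matrix (∀ k, κ' k) (∀ k, κ'' k) ℂ) :
    partyKronecker A B * partyKronecker A' B' = partyKronecker (A * A') (B * B') := by
  rw [partyKronecker, partyKronecker, submatrix_mul_equiv, ← mul_kronecker_mul, partyKronecker]

omit [Fintype P] [DecidableEq P] in
theorem sum_partyKronecker {J : Type*} (s : Finset J) (A : J → Matrix (∀ k, ι k) (∀ k, ι' k) ℂ)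
    (B : Matrix (∀ k, κ k) (∀ k, κ' k) ℂ) :
    partyKronecker (∑ j ∈ s, A j) B = ∑ j ∈ s, partyKronecker (A j) B := by
  ext x y
  simp [partyKronecker, Matrix.sum_apply, Finset.sum_mul]

omit [DecidableEq P] in
theorem partyKronecker_piTensor (A : ∀ k, Matrix (ι k) (ι' k) ℂ)
    (B : ∀ k, Matrix (κ k) (κ' k) ℂ) :
    partyKronecker (piTensor A) (piTensor B) = piTensor fun k => A k ⊗ₖ B k := by
  ext x y
  simp [partyKronecker, piTensor, Finset.prod_mul_distrib, kroneckerMap,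
    Equiv.arrowProdEquivProdArrow]

omit [DecidableEq P] in
theorem partyKronecker_one [∀ k, DecidableEq (ι k)] [∀ k, DecidableEq (κ k)] :
    partyKronecker (1 : Matrix (∀ k, ι k) (∀ k, ι k) ℂ) (1 : Matrix (∀ k, κ k) (∀ k, κ k) ℂ) =
      1 := by
  rw [partyKronecker, one_kronecker_one, submatrix_one_equiv]

omit [Fintype P] [DecidableEq P] in
theorem partyKronecker_submatrix_swap (A : Matrix (∀ k, ι k) (∀ k, ι' k) ℂ)
    (B : Matrix (∀ k, κ k) (∀ k, κ' k) ℂ) :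
    (partyKronecker A B).submatrix (Equiv.piCongrRight fun k => Equiv.prodComm (κ k) (ι k))
      (Equiv.piCongrRight fun k => Equiv.prodComm (κ' k) (ι' k)) = partyKronecker B A := by
  ext x y
  exact mul_comm _ _

end PartyKronecker

section Product

variable {Ω₁ Ω₂ : Type} [DecidableEq Ω₁] [DecidableEq Ω₂] {ι κ : P → Type}
  [∀ k, Fintype (ι k)] [∀ k, DecidableEq (ι k)] [∀ k, Fintype (κ k)] [∀ k, DecidableEq (κ k)]

theorem IsLOCC.partyKronecker_comm {M : Ω₁ → Matrix (∀ k, ι k) (∀ k, ι k) ℂ}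
    {N : Ω₂ → Matrix (∀ k, κ k) (∀ k, κ k) ℂ}
    (h : IsLOCC (fun k => ι k × κ k) fun o : Ω₁ × Ω₂ => partyKronecker (M o.1) (N o.2)) :
    IsLOCC (fun k => κ k × ι k) fun o : Ω₂ × Ω₁ => partyKronecker (N o.1) (M o.2) := by
  have hswap := h.relabel (Equiv.prodComm Ω₂ Ω₁) fun k => Equiv.prodComm (κ k) (ι k)
  simp only [partyKronecker_submatrix_swap] at hswap
  exact hswap

theorem IsLOCC.round_partyKronecker (k : P) {r : ℕ} {ι' : Fin r → P → Type}
    [∀ j l, Fintype (ι' j l)] [∀ j l, DecidableEq (ι' j l)]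
    (B : ∀ (j : Fin r) (l : P), Matrix (ι' j l) (ι l) ℂ) (hk : ∑ j, (B j k)ᴴ * B j k = 1)
    (hne : ∀ j l, l ≠ k → (B j l)ᴴ * B j l = 1)
    {M : ∀ j : Fin r, Ω₁ → Matrix (∀ l, ι' j l) (∀ l, ι' j l) ℂ}
    {N : Ω₂ → Matrix (∀ l, κ l) (∀ l, κ l) ℂ}
    (h : ∀ j, IsLOCC (fun l => ι' j l × κ l) fun o : Ω₁ × Ω₂ => partyKronecker (M j o.1) (N o.2)) :
    IsLOCC (fun l => ι l × κ l) fun o : Ω₁ × Ω₂ =>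
      partyKronecker (∑ j, (piTensor (B j))ᴴ * M j o.1 * piTensor (B j)) (N o.2) := by
  have hgram (j : Fin r) (l : P) : (B j l ⊗ₖ (1 : Matrix (κ l) (κ l) ℂ))ᴴ *
      (B j l ⊗ₖ (1 : Matrix (κ l) (κ l) ℂ)) = ((B j l)ᴴ * B j l) ⊗ₖ 1 := by
    rw [conjTranspose_kronecker, ← mul_kronecker_mul, conjTranspose_one, Matrix.one_mul]
  convert IsLOCC.round (fun l => ι l × κ l) k r (fun j l => ι' j l × κ l)
    (fun j l => B j l ⊗ₖ (1 : Matrix (κ l) (κ l) ℂ)) ?_ ?_ _ h using 2 with o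
  · rw [sum_partyKronecker]
    refine Finset.sum_congr rfl fun j _ => ?_
    rw [← partyKronecker_piTensor, piTensor_one, conjTranspose_partyKronecker, partyKronecker_mul,
      partyKronecker_mul, conjTranspose_one, Matrix.one_mul, Matrix.mul_one]
  · simp only [hgram]
    rw [← one_kronecker_one, ← hk]
    ext x y
    simp [Matrix.sum_apply, kroneckerMap, Finset.sum_mul]
  · intro j l hl
    rw [hgram, hne j l hl, one_kronecker_one]

theorem IsLOCC.guess_partyKronecker (c : Ω₁) {N : Ω₂ → Matrix (∀ k, κ k) (∀ k, κ k) ℂ}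
    (hN : IsLOCC κ N) :
    IsLOCC (fun k => ι k × κ k) fun o : Ω₁ × Ω₂ =>
      LOCCSeq.partyKronecker (if o.1 = c then (1 : Matrix (∀ k, ι k) (∀ k, ι k) ℂ) else 0)
        (N o.2) := by
  induction hN with
  | guess κ c' =>
    convert IsLOCC.guess (fun k => ι k × κ k) (c, c') using 2 with o
    simp only [Prod.ext_iff, ite_and]
    split_ifs
    exacts [partyKronecker_one, by simp [LOCCSeq.partyKronecker],
      by simp [LOCCSeq.partyKronecker], by simp [LOCCSeq.partyKronecker]]
  | round κ k r κ' B hk hne N _ ih =>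
    let guess (o : Ω₁) : Matrix (∀ k, ι k) (∀ k, ι k) ℂ := if o = c then 1 else 0
    exact partyKronecker_comm (N := guess)
      (M := fun o => ∑ j, (piTensor (B j))ᴴ * N j o * piTensor (B j))
      (round_partyKronecker k B hk hne fun j => partyKronecker_comm (M := guess) (ih j))

theorem IsLOCC.partyKronecker {M : Ω₁ → Matrix (∀ k, ι k) (∀ k, ι k) ℂ}
    {N : Ω₂ → Matrix (∀ k, κ k) (∀ k, κ k) ℂ} (hM : IsLOCC ι M) (hN : IsLOCC κ N) :
    IsLOCC (fun k => ι k × κ k) fun o : Ω₁ × Ω₂ => LOCCSeq.partyKronecker (M o.1) (N o.2) := by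
  induction hM with
  | guess ι c => exact hN.guess_partyKronecker c
  | round ι k r ι' B hk hne M _ ih => exact round_partyKronecker k B hk hne ih

end Product

theorem IsLOCC.partyTensor_fin {L : ℕ} {ι : Fin L → P → Type} [∀ l k, Fintype (ι l k)]
    [∀ l k, DecidableEq (ι l k)] {Ω : Fin L → Type} [∀ l, DecidableEq (Ω l)]
    {M : ∀ l, Ω l → Matrix (∀ k, ι l k) (∀ k, ι l k) ℂ} (hM : ∀ l, IsLOCC (ι l) (M l)) :
    IsLOCC (fun k => ∀ l, ι l k) fun c : ∀ l, Ω l => partyTensor fun l => M l (c l) := by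
  induction L with
  | zero =>
    convert IsLOCC.guess (fun k => ∀ l, ι l k) (fun l => l.elim0 : ∀ l, Ω l) with c
    rw [if_pos (Subsingleton.elim _ _), ← partyTensor_one]
    congr 1
    exact Subsingleton.elim _ _
  | succ L ih =>
    convert ((hM 0).partyKronecker (ih fun l => hM l.succ)).relabel (Fin.consEquiv Ω).symm
      fun k => (Fin.consEquiv fun l => ι l k).symm using 2 with c
    ext x y
    exact Fin.prod_univ_succ fun l => M l (c l) (fun k => x k l) fun k => y k l

theorem IsLOCC.partyTensor {I : Type} [Fintype I] [DecidableEq I] {ι : I → P → Type}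
    [∀ l k, Fintype (ι l k)] [∀ l k, DecidableEq (ι l k)] {Ω : I → Type}
    [∀ l, DecidableEq (Ω l)] {M : ∀ l, Ω l → Matrix (∀ k, ι l k) (∀ k, ι l k) ℂ}
    (hM : ∀ l, IsLOCC (ι l) (M l)) :
    IsLOCC (fun k => ∀ l, ι l k) fun c : ∀ l, Ω l => LOCCSeq.partyTensor fun l => M l (c l) := by
  have e := Fintype.equivFin I
  convert (partyTensor_fin fun i => hM (e.symm i)).relabel (Equiv.piCongrLeft' Ω e)
    fun k => Equiv.piCongrLeft' (fun l => ι l k) e using 2 with c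
  ext x y
  exact (e.symm.prod_comp fun l => M l (c l) (fun k => x k l) fun k => y k l).symm

end LOCC

theorem prod_csSup_le {α : Type*} [Fintype α] {S : α → Set ℝ} {b : ℝ}
    (hne : ∀ i, (S i).Nonempty) (hbdd : ∀ i, BddAbove (S i))
    (h : ∀ x : α → ℝ, (∀ i, x i ∈ S i) → ∏ i, x i ≤ b) : ∏ i, sSup (S i) ≤ b := by
  choose u _ hlim hmem using fun i => exists_seq_tendsto_sSup (hne i) (hbdd i)
  exact le_of_tendsto (tendsto_finsetProd _ fun i _ => hlim i)
    (.of_forall fun t => h _ fun i => hmem i t)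

theorem prod_eq_prod_iff_of_pos_of_le {α : Type*} [Fintype α] {a b : α → ℝ} (ha : ∀ i, 0 < a i)
    (hab : ∀ i, a i ≤ b i) : ∏ i, a i = ∏ i, b i ↔ ∀ i, a i = b i := by
  refine ⟨fun h i => ?_, fun h => Finset.prod_congr rfl fun i _ => h i⟩
  by_contra hi
  exact (Finset.prod_lt_prod (fun i _ => ha i) (fun i _ => hab i)
    ⟨i, Finset.mem_univ i, (hab i).lt_of_ne hi⟩).ne h

section Sequence

variable {I P : Type} [Fintype I] [DecidableEq I] [Fintype P] [DecidableEq P]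
  {ι : I → P → Type} [∀ l k, Fintype (ι l k)] [∀ l k, DecidableEq (ι l k)]
  {Ω : I → Type} [∀ l, Fintype (Ω l)] [∀ l, DecidableEq (Ω l)]
  (E : ∀ l, Ensemble (Ω l) (∀ k, ι l k))

theorem Ensemble.prod_pL_le_pL_tensor : ∏ l, pL (E l) ≤ pL (Ensemble.tensor E) := by
  refine prod_csSup_le (fun l => (E l).nonempty_setOf_success_isLOCC)
    (fun l => (E l).bddAbove_setOf_success_isLOCC) fun p hp => ?_
  choose M hM hsuccess using hp
  simp only [hsuccess]
  rw [← success_tensor E fun l i => ((hM l).isMeasurement.1 i).isHermitian]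
  exact success_le_pL _ (IsLOCC.partyTensor hM)

end Sequence

end LOCCSeq

theorem theorem3_general {I P : Type} [Fintype I] [DecidableEq I] [Fintype P] [DecidableEq P]
    {ι : I → P → Type} [∀ l k, Fintype (ι l k)] [∀ l k, DecidableEq (ι l k)]
    {Ω : I → Type} [∀ l, Fintype (Ω l)] [∀ l, DecidableEq (Ω l)]
    (E : ∀ l, LOCCSeq.Ensemble (Ω l) (∀ k, ι l k)) :
    (∏ l, LOCCSeq.pL (E l) = LOCCSeq.pL (LOCCSeq.Ensemble.tensor E) ∧
      LOCCSeq.pL (LOCCSeq.Ensemble.tensor E) = LOCCSeq.pG (LOCCSeq.Ensemble.tensor E)) ↔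
    ∀ l, LOCCSeq.pL (E l) = LOCCSeq.pG (E l) := by
  have hL := LOCCSeq.Ensemble.prod_pL_le_pL_tensor E
  have hLG := LOCCSeq.Ensemble.pL_le_pG (LOCCSeq.Ensemble.tensor E)
  rw [← LOCCSeq.prod_eq_prod_iff_of_pos_of_le (fun l => (E l).pL_pos) fun l => (E l).pL_le_pG]
  rw [LOCCSeq.Ensemble.pG_tensor] at hLG ⊢
  exact ⟨fun h => h.1.trans h.2,
    fun h => ⟨hL.antisymm (hLG.trans_eq h.symm), hLG.antisymm (h.symm.trans_le hL)⟩⟩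

theorem theorem3 (m L : ℕ) (d : Fin L → Fin m → ℕ) (n : Fin L → ℕ)
    (E : ∀ l : Fin L, LOCCSeq.Ensemble (Fin (n l)) (∀ k : Fin m, Fin (d l k))) :
    (∏ l, LOCCSeq.pL (E l) = LOCCSeq.pL (LOCCSeq.Ensemble.tensor E) ∧
      LOCCSeq.pL (LOCCSeq.Ensemble.tensor E) = LOCCSeq.pG (LOCCSeq.Ensemble.tensor E)) ↔
    ∀ l : Fin L, LOCCSeq.pL (E l) = LOCCSeq.pG (E l) :=
  theorem3_general E
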